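/- Let $n\ge 0$, let $M\in\mathbb{C}^{n\times n}$, and let $\alpha,\beta\in\mathbb{C}$ with $\beta\neq 0$. Let $\mathfrak{S}_n$ be the symmetric group on $[n]=\{1,\dots,n\}$, and for $\sigma\in\mathfrak{S}_n$ let $\#\sigma$ be the number of cycles of $\sigma$ (fixed points included). Define the $\alpha$-permanent by $$\operatorname{per}_\alpha M=\sum_{\sigma\in\mathfrak{S}_n}\alpha^{\#\sigma}\prod_{j=1}^n M_{j,\sigma(j)}.$$ For an integer partition $\lambda\vdash n$ let $\chi_\lambda$ be the character of the Specht module $S^\lambda$ over $\mathbb{C}$, and put $$\operatorname{Imm}_\lambda M=\sum_{\sigma\in\mathfrak{S}_n}\chi_\lambda(\sigma)\prod_{j=1}^n M_{j,\sigma(j)},\qquad c_\lambda(x)=\frac1{n!}\sum_{\sigma\in\mathfrak{S}_n}x^{\#\sigma}\chi_\lambda(\sigma)\quad(x\in\mathbb{C}).$$ Let $\mathcal{P}_n$ be the collection of set partitions of $[n]$. For $\pi\in\mathcal{P}_n$ let $\#\pi$ be its number of blocks, and let $M\cdot\pi$ be the matrix whose $(i,j)$ entry is $M_{i,j}$ if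 $i$ and $j$ are in the same block of $\pi$ and $0$ otherwise. Write $x^{\downarrow k}=x(x-1)\cdots(x-k+1)$. Then $$\operatorname{per}_\alpha M=\sum_{\lambda\vdash n}c_\lambda(-\beta)\sum_{\pi\in\mathcal{P}_n}\left(-\frac{\alpha}{\beta}\right)^{\downarrow\#\pi}\operatorname{Imm}_\lambda(M\cdot\pi).$$ -/

import Mathlib

open scoped Matrix

noncomputable section

/-! ### Cycles, the α-permanent, and block diagonal projections -/

/-- The number `#σ` of cycles of a permutation, each fixed point being a cycle of length one:
the number of classes of the relation "`i` and `j` lie in the same cycle of `σ`". -/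
def numCycles {n : ℕ} (σ : Equiv.Perm (Fin n)) : ℕ :=
  Nat.card (Quotient (Equiv.Perm.SameCycle.setoid σ))

/-- The α-permanent `∑_σ α ^ #σ ∏_j M_{j, σ j}`. -/
def alphaPermanent {n : ℕ} (α : ℂ) (M : Matrix (Fin n) (Fin n) ℂ) : ℂ :=
  ∑ σ : Equiv.Perm (Fin n), α ^ numCycles σ * ∏ j, M j (σ j)

/-- Set partitions of `[n]`. -/
abbrev SetPartition (n : ℕ) : Type := Finpartition (Finset.univ : Finset (Fin n))

open Classical in
/-- A set partition as a matrix: the entry at `(i, j)` is `1` if `i` and `j` are in the same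
block and `0` otherwise. -/
def SetPartition.toMatrix {n : ℕ} (π : SetPartition n) : Matrix (Fin n) (Fin n) ℂ :=
  Matrix.of fun i j => if ∃ b ∈ π.parts, i ∈ b ∧ j ∈ b then 1 else 0

/-- The block diagonal projection `M · π`, a Hadamard product. -/
def blockProjection {n : ℕ} (M : Matrix (Fin n) (Fin n) ℂ) (π : SetPartition n) :
    Matrix (Fin n) (Fin n) ℂ :=
  M ⊙ SetPartition.toMatrix π

/-- The falling factorial `x (x - 1) ⋯ (x - k + 1)`. -/
def fallingFactorial (x : ℂ) (k : ℕ) : ℂ :=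
  ∏ i ∈ Finset.range k, (x - (i : ℂ))

/-! ### Specht modules and their characters -/

/-- The row lengths of an integer partition, in weakly decreasing order. -/
def partitionRows {n : ℕ} (lam : n.Partition) : List ℕ :=
  lam.parts.sort (· ≥ ·)

theorem partitionRows_sortedGE {n : ℕ} (lam : n.Partition) :
    (partitionRows lam).SortedGE :=
  (Multiset.pairwise_sort lam.parts (· ≥ ·)).sortedGE

/-- The Young diagram of an integer partition (cells are pairs `(row, column)`). -/
def partitionDiagram {n : ℕ} (lam : n.Partition) : YoungDiagram :=
  YoungDiagram.ofRowLens (partitionRows lam) (partitionRows_sortedGE lam)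

theorem card_cellsOfRowLens (w : List ℕ) :
    (YoungDiagram.cellsOfRowLens w).card = w.sum := by
  induction w with
  | nil => simp [YoungDiagram.cellsOfRowLens]
  | cons a w ih =>
    rw [YoungDiagram.cellsOfRowLens, Finset.card_union_of_disjoint]
    · simp [ih]
    · rw [Finset.disjoint_left]
      rintro ⟨i, j⟩ h h'
      simp only [Finset.mem_product, Finset.mem_singleton] at h
      simp only [Finset.mem_map] at h'
      obtain ⟨⟨a, b⟩, _, hab⟩ := h'
      have := congrArg Prod.fst hab
      simp at this
      omega

theorem card_partitionDiagram {n : ℕ} (lam : n.Partition) :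
    (partitionDiagram lam).cells.card = n := by
  change (YoungDiagram.cellsOfRowLens (partitionRows lam)).card = n
  rw [card_cellsOfRowLens, ← Multiset.sum_coe, partitionRows, Multiset.sort_eq, lam.parts_sum]

/-- The canonical tableau of shape `lam`: the cells are numbered consecutively along the rows,
from top to bottom, and each label is sent to its cell. -/
def canonicalTableau {n : ℕ} (lam : n.Partition) (i : Fin n) : ℕ × ℕ :=
  ofLex (((partitionDiagram lam).cells.map (toLex (α := ℕ × ℕ)).toEmbedding).orderEmbOfFin
    ((Finset.card_map _).trans (card_partitionDiagram lam)) i)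

/-- The row group `{σ : σ preserves each row of the canonical tableau}`. -/
def rowGroup {n : ℕ} (lam : n.Partition) : Subgroup (Equiv.Perm (Fin n)) where
  carrier := {σ | ∀ i, (canonicalTableau lam (σ i)).1 = (canonicalTableau lam i).1}
  one_mem' _ := rfl
  mul_mem' {σ τ} hσ hτ i := (hσ (τ i)).trans (hτ i)
  inv_mem' {σ} hσ i := by
    have h := hσ (σ⁻¹ i)
    rw [show σ (σ⁻¹ i) = i from σ.apply_symm_apply i] at h
    exact h.symm

/-- The column group `{σ : σ preserves each column of the canonical tableau}`. -/
def columnGroup {n : ℕ} (lam : n.Partition) : Subgroup (Equiv.Perm (Fin n)) where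
  carrier := {σ | ∀ i, (canonicalTableau lam (σ i)).2 = (canonicalTableau lam i).2}
  one_mem' _ := rfl
  mul_mem' {σ τ} hσ hτ i := (hσ (τ i)).trans (hτ i)
  inv_mem' {σ} hσ i := by
    have h := hσ (σ⁻¹ i)
    rw [show σ (σ⁻¹ i) = i from σ.apply_symm_apply i] at h
    exact h.symm

/-- The complex group algebra of the symmetric group. -/
abbrev SymGroupAlgebra (n : ℕ) : Type := MonoidAlgebra ℂ (Equiv.Perm (Fin n))

open Classical in
/-- The Young symmetrizer `(∑_{p ∈ rows} p) (∑_{q ∈ columns} sgn(q) q)`. -/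
def youngSymmetrizer {n : ℕ} (lam : n.Partition) : SymGroupAlgebra n :=
  (∑ p : rowGroup lam, MonoidAlgebra.of ℂ _ (p : Equiv.Perm (Fin n))) *
    ∑ q : columnGroup lam,
      ((Equiv.Perm.sign (q : Equiv.Perm (Fin n)) : ℤ) : ℂ) •
        MonoidAlgebra.of ℂ _ (q : Equiv.Perm (Fin n))

/-- The Specht module: the left ideal of the group algebra generated by the
Young symmetrizer. -/
abbrev spechtModule {n : ℕ} (lam : n.Partition) : Ideal (SymGroupAlgebra n) :=
  Ideal.span {youngSymmetrizer lam}

/-- The action of the symmetric group on the Specht module by left multiplication. -/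
def spechtRepresentation {n : ℕ} (lam : n.Partition) :
    Representation ℂ (Equiv.Perm (Fin n)) (spechtModule lam) :=
  (Algebra.lsmul ℂ ℂ (spechtModule lam)).toMonoidHom.comp
    (MonoidAlgebra.of ℂ (Equiv.Perm (Fin n)))

/-- The irreducible character `χ_lam` of the symmetric group. -/
def spechtCharacter {n : ℕ} (lam : n.Partition) (σ : Equiv.Perm (Fin n)) : ℂ :=
  (spechtRepresentation lam).character σ

/-- The immanant `∑_σ χ_lam(σ) ∏_j M_{j, σ j}`. -/
def immanant {n : ℕ} (lam : n.Partition) (M : Matrix (Fin n) (Fin n) ℂ) : ℂ :=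
  ∑ σ : Equiv.Perm (Fin n), spechtCharacter lam σ * ∏ j, M j (σ j)

/-- The coefficient `c_lam(α) = (1 / n!) ∑_σ α ^ #σ χ_lam(σ)`. -/
def immanantCoeff {n : ℕ} (lam : n.Partition) (α : ℂ) : ℂ :=
  (1 / (n.factorial : ℂ)) *
    ∑ σ : Equiv.Perm (Fin n), α ^ numCycles σ * spechtCharacter lam σ

end

/-! Two expansions of the function `σ ↦ x ^ numCycles σ` carry the proof. First, for natural `m`, `m
^ numCycles σ` counts the colourings of `[n]` by `m` colours that are constant on the cycles of `σ`.
Sorting them by their kernel gives a sum of falling factorials of `m` over the set partitions whose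
blocks `σ` preserves, and polynomial identity extends this to complex `x` (`pow_numCycles`). A
block-preserving `σ` is exactly one whose matching product keeps all its factors in `M · π`, so
writing `(a * b) ^ #σ = a ^ #σ * b ^ #σ` and expanding only the power of `a` yields
`alphaPermanent_mul`.

Second, `x ^ numCycles σ` is a class function, hence a combination of Specht characters, with
coefficients `immanantCoeff` read off by orthogonality (`pow_numCycles_eq_sum`). This turns an
α-permanent into immanants (`alphaPermanent_eq_sum_immanant`). The theorem follows by factoring `α =
(-α / β) * (-β)`, with the set partitions taking the first factor and the immanants the second.

The long part is orthogonality and completeness of the Specht characters. Tableau combinatorics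
controls products of Young symmetrizers; a trace formula turns these products into sums of
characters; counting partitions of `n` as cycle types gives completeness. -/

open scoped Matrix

noncomputable section

/-! ### Set partitions and powers of the number of cycles -/

open Classical in
theorem toMatrix_apply {n : ℕ} (π : SetPartition n) (i j : Fin n) :
    SetPartition.toMatrix π i j = if π.part i = π.part j then 1 else 0 := by
  have h : (∃ b ∈ π.parts, i ∈ b ∧ j ∈ b) ↔ π.part i = π.part j := by
    rw [← π.mem_part_iff_part_eq_part (Finset.mem_univ _) (Finset.mem_univ _),
      π.mem_part_iff_exists]
  simp only [SetPartition.toMatrix, Matrix.of_apply, h]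

theorem SetPartition.ext_part {n : ℕ} {π π' : SetPartition n}
    (h : ∀ i j, π.part i = π.part j ↔ π'.part i = π'.part j) : π = π' := by
  have hp : ∀ i, π.part i = π'.part i := fun i => by
    ext j
    rw [π.mem_part_iff_part_eq_part (Finset.mem_univ _) (Finset.mem_univ _),
      π'.mem_part_iff_part_eq_part (Finset.mem_univ _) (Finset.mem_univ _), h]
  have key : ∀ (π π' : SetPartition n), (∀ i, π.part i = π'.part i) → π.parts ⊆ π'.parts := by
    intro π π' hp b hb
    obtain ⟨i, hi⟩ := π.nonempty_of_mem_parts hb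
    rw [← π.part_eq_of_mem hb hi, hp]
    exact π'.part_mem.2 (Finset.mem_univ _)
  exact Finpartition.ext (Finset.Subset.antisymm (key _ _ hp) (key _ _ fun i => (hp i).symm))

/-- The partition of `[n]` into the fibres of a function. -/
def kernelPartition {n : ℕ} {β : Type*} [DecidableEq β] (f : Fin n → β) : SetPartition n :=
  haveI : DecidableRel (Setoid.ker f).r := fun i j => inferInstanceAs (Decidable (f i = f j))
  Finpartition.ofSetoid (Setoid.ker f)

theorem kernelPartition_part {n : ℕ} {β : Type*} [DecidableEq β] (f : Fin n → β) (i j : Fin n) :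
    (kernelPartition f).part i = (kernelPartition f).part j ↔ f i = f j := by
  rw [← Finpartition.mem_part_iff_part_eq_part _ (Finset.mem_univ _) (Finset.mem_univ _),
    kernelPartition, Finpartition.mem_part_ofSetoid_iff_rel]
  exact eq_comm

theorem kernelPartition_eq_iff {n : ℕ} {β : Type*} [DecidableEq β] (f : Fin n → β)
    (π : SetPartition n) :
    kernelPartition f = π ↔ ∀ i j, f i = f j ↔ π.part i = π.part j := by
  constructor
  · rintro rfl i j
    exact (kernelPartition_part f i j).symm
  · intro h
    exact SetPartition.ext_part fun i j => (kernelPartition_part f i j).trans (h i j)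

/-- Functions with a prescribed kernel are injective functions on the blocks. -/
def kernelEquivEmbedding {n : ℕ} {β : Type*} (π : SetPartition n) :
    {f : Fin n → β // ∀ i j, f i = f j ↔ π.part i = π.part j} ≃ (π.parts ↪ β) where
  toFun f := ⟨fun b => f.1 (π.nonempty_of_mem_parts b.2).choose, fun b c h => by
    have h' := (f.2 _ _).1 h
    rw [π.part_eq_of_mem b.2 (π.nonempty_of_mem_parts b.2).choose_spec,
      π.part_eq_of_mem c.2 (π.nonempty_of_mem_parts c.2).choose_spec] at h'
    exact Subtype.ext h'⟩
  invFun g := ⟨fun i => g ⟨π.part i, π.part_mem.2 (Finset.mem_univ _)⟩, fun i j => by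
    rw [g.injective.eq_iff, Subtype.mk_eq_mk]⟩
  left_inv f := by
    ext i
    refine (f.2 _ _).2 (π.part_eq_of_mem (π.part_mem.2 (Finset.mem_univ i)) ?_)
    exact (π.nonempty_of_mem_parts (π.part_mem.2 (Finset.mem_univ i))).choose_spec
  right_inv g := by
    ext b
    refine congrArg g (Subtype.ext ?_)
    exact π.part_eq_of_mem b.2 (π.nonempty_of_mem_parts b.2).choose_spec

theorem card_kernelPartition_eq {n m : ℕ} (π : SetPartition n) :
    (Finset.univ.filter fun f : Fin n → Fin m => kernelPartition f = π).card =
      m.descFactorial π.parts.card := by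
  simp only [kernelPartition_eq_iff]
  rw [← Fintype.card_subtype, Fintype.card_congr (kernelEquivEmbedding π),
    Fintype.card_embedding_eq, Fintype.card_fin, Fintype.card_coe]

theorem eq_of_sameCycle {n : ℕ} {β : Type*} {σ : Equiv.Perm (Fin n)} {f : Fin n → β}
    (h : ∀ j, f (σ j) = f j) {i j : Fin n} (hij : σ.SameCycle i j) : f i = f j := by
  obtain ⟨k, rfl⟩ := hij.exists_nat_pow_eq
  clear hij
  induction k with
  | zero => rfl
  | succ k ih => rw [pow_succ', Equiv.Perm.mul_apply, h, ← ih]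

/-- An invariant function is the same as a function on the quotient by the cycle relation. -/
theorem card_invariant_functions {n m : ℕ} (σ : Equiv.Perm (Fin n)) :
    (Finset.univ.filter fun f : Fin n → Fin m => ∀ j, f (σ j) = f j).card =
      m ^ numCycles σ := by
  classical
  have e : {f : Fin n → Fin m // ∀ j, f (σ j) = f j} ≃
      (Quotient (Equiv.Perm.SameCycle.setoid σ) → Fin m) :=
    (Equiv.subtypeEquivRight fun f => ⟨fun h i j hij => eq_of_sameCycle h hij,
      fun h j => h (Equiv.Perm.sameCycle_apply_left.2 (Equiv.Perm.SameCycle.refl σ j))⟩).trans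
      (Setoid.liftEquiv (Equiv.Perm.SameCycle.setoid σ))
  rw [← Fintype.card_subtype, Fintype.card_congr e, Fintype.card_fun, Fintype.card_fin,
    numCycles, Nat.card_eq_fintype_card]

/-- Invariant functions are grouped by kernel: whether `f` is `σ`-invariant depends only on the
kernel of `f`, and each kernel `π` is realised by the injections of its blocks into `Fin m`. -/
theorem natCast_pow_numCycles {n : ℕ} (m : ℕ) (σ : Equiv.Perm (Fin n)) :
    m ^ numCycles σ = ∑ π : SetPartition n with ∀ j, π.part j = π.part (σ j),
      m.descFactorial π.parts.card := by
  rw [← card_invariant_functions]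
  rw [Finset.card_eq_sum_card_fiberwise (f := kernelPartition)
    (t := Finset.univ.filter fun π : SetPartition n => ∀ j, π.part j = π.part (σ j))]
  · refine Finset.sum_congr rfl fun π hπ => ?_
    rw [← card_kernelPartition_eq, Finset.filter_filter]
    congr 1
    ext f
    simp only [Finset.mem_filter, Finset.mem_univ, true_and, and_iff_right_iff_imp] at hπ ⊢
    rintro rfl j
    exact ((kernelPartition_part f _ _).1 (hπ j)).symm
  · intro f hf
    simp only [Finset.coe_filter, Finset.mem_univ, true_and, Set.mem_ofPred_eq] at hf ⊢
    exact fun j => (kernelPartition_part f _ _).2 (hf j).symm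

theorem fallingFactorial_eq_eval (x : ℂ) (k : ℕ) :
    fallingFactorial x k = (descPochhammer ℂ k).eval x := by
  induction k with
  | zero => simp [fallingFactorial]
  | succ k ih => rw [descPochhammer_succ_eval, ← ih, fallingFactorial, Finset.prod_range_succ,
      fallingFactorial]

/-- Both sides are polynomials in `x` that agree at every natural number. -/
theorem pow_numCycles {n : ℕ} (x : ℂ) (σ : Equiv.Perm (Fin n)) :
    x ^ numCycles σ = ∑ π : SetPartition n with ∀ j, π.part j = π.part (σ j),
      fallingFactorial x π.parts.card := by
  have h : (Polynomial.X ^ numCycles σ : Polynomial ℂ) =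
      ∑ π : SetPartition n with ∀ j, π.part j = π.part (σ j),
        descPochhammer ℂ π.parts.card := by
    refine Polynomial.eq_of_infinite_eval_eq _ _ ((Set.infinite_range_of_injective
      (Nat.cast_injective (R := ℂ))).mono ?_)
    rintro _ ⟨m, rfl⟩
    simp only [Set.mem_ofPred_eq, Polynomial.eval_pow, Polynomial.eval_X, Polynomial.eval_finsetSum,
      descPochhammer_eval_eq_descFactorial]
    exact_mod_cast congrArg (Nat.cast (R := ℂ)) (natCast_pow_numCycles m σ)
  simpa [Polynomial.eval_finsetSum, fallingFactorial_eq_eval] using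
    congrArg (Polynomial.eval x) h

theorem prod_blockProjection {n : ℕ} (M : Matrix (Fin n) (Fin n) ℂ) (π : SetPartition n)
    (σ : Equiv.Perm (Fin n)) :
    ∏ j, blockProjection M π j (σ j) =
      if ∀ j, π.part j = π.part (σ j) then ∏ j, M j (σ j) else 0 := by
  classical
  simp only [blockProjection, Matrix.hadamard_apply, toMatrix_apply, Finset.prod_mul_distrib,
    Finset.prod_ite_zero, Finset.mem_univ, true_imp_iff, Finset.prod_const_one]
  split_ifs <;> simp_all

/-- Only `a ^ #σ` is expanded over set partitions; the condition that `σ` preserve the blocks is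
absorbed by `M · π`, whose products vanish otherwise. -/
theorem alphaPermanent_mul {n : ℕ} (a b : ℂ) (M : Matrix (Fin n) (Fin n) ℂ) :
    alphaPermanent (a * b) M = ∑ π : SetPartition n,
      fallingFactorial a π.parts.card * alphaPermanent b (blockProjection M π) := by
  simp only [alphaPermanent, Finset.mul_sum]
  rw [Finset.sum_comm]
  refine Finset.sum_congr rfl fun σ _ => ?_
  rw [mul_pow, pow_numCycles a, Finset.sum_mul, Finset.sum_mul, Finset.sum_filter]
  refine Finset.sum_congr rfl fun π _ => ?_
  rw [prod_blockProjection]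
  split_ifs <;> ring

/-! ### Rows and columns of tableaux -/

theorem canonicalTableau_mem {n : ℕ} (lam : n.Partition) (i : Fin n) :
    canonicalTableau lam i ∈ partitionDiagram lam := by
  have h := Finset.orderEmbOfFin_mem
    ((partitionDiagram lam).cells.map (toLex (α := ℕ × ℕ)).toEmbedding)
    ((Finset.card_map _).trans (card_partitionDiagram lam)) i
  rw [Finset.mem_map] at h
  obtain ⟨c, hc, h⟩ := h
  rw [canonicalTableau, ← h]
  exact hc

theorem canonicalTableau_injective {n : ℕ} (lam : n.Partition) :
    Function.Injective (canonicalTableau lam) := fun _ _ h =>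
  (Finset.orderEmbOfFin _ _).injective (ofLex.injective h)

theorem image_canonicalTableau {n : ℕ} (lam : n.Partition) :
    Finset.univ.image (canonicalTableau lam) = (partitionDiagram lam).cells := by
  refine Finset.eq_of_subset_of_card_le (fun c hc => ?_) ?_
  · obtain ⟨i, -, rfl⟩ := Finset.mem_image.1 hc
    exact canonicalTableau_mem lam i
  · rw [Finset.card_image_of_injective _ (canonicalTableau_injective lam), Finset.card_fin,
      card_partitionDiagram]

theorem exists_canonicalTableau_eq {n : ℕ} {lam : n.Partition} {c : ℕ × ℕ}
    (hc : c ∈ partitionDiagram lam) : ∃ i, canonicalTableau lam i = c := by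
  rw [← YoungDiagram.mem_cells, ← image_canonicalTableau] at hc
  simpa using hc

/-- The number of entries of the canonical tableau in the rows before row `r`. -/
def rowsBefore {n : ℕ} (lam : n.Partition) (r : ℕ) : ℕ :=
  (Finset.univ.filter fun i => (canonicalTableau lam i).1 < r).card

theorem card_filter_tableau {n : ℕ} (lam : n.Partition) (p : ℕ × ℕ → Prop) [DecidablePred p] :
    (Finset.univ.filter fun i => p (canonicalTableau lam i)).card =
      ((partitionDiagram lam).cells.filter p).card := by
  rw [← image_canonicalTableau, Finset.filter_image,
    Finset.card_image_of_injective _ (canonicalTableau_injective lam)]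

theorem card_column {n : ℕ} (lam : n.Partition) (j : ℕ) :
    (Finset.univ.filter fun i => (canonicalTableau lam i).2 = j).card =
      (partitionDiagram lam).colLen j := by
  rw [card_filter_tableau lam fun c => c.2 = j, YoungDiagram.colLen_eq_card]
  rfl

theorem card_column_rowsBefore {n : ℕ} (lam : n.Partition) (j r : ℕ) :
    (Finset.univ.filter fun i => (canonicalTableau lam i).1 < r ∧
      (canonicalTableau lam i).2 = j).card = min r ((partitionDiagram lam).colLen j) := by
  rw [card_filter_tableau lam fun c => c.1 < r ∧ c.2 = j]
  have h : (partitionDiagram lam).cells.filter (fun c => c.1 < r ∧ c.2 = j) =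
      (Finset.range (min r ((partitionDiagram lam).colLen j))).map
        ⟨fun i => (i, j), fun a b h => (Prod.ext_iff.1 h).1⟩ := by
    ext c
    obtain ⟨a, b⟩ := c
    simp only [Finset.mem_filter, YoungDiagram.mem_cells, YoungDiagram.mem_iff_lt_colLen,
      Finset.mem_map, Finset.mem_range, lt_min_iff]
    constructor
    · rintro ⟨h1, h2, rfl⟩
      exact ⟨a, ⟨h2, h1⟩, rfl⟩
    · rintro ⟨i, ⟨h1, h2⟩, h⟩
      obtain ⟨rfl, rfl⟩ := Prod.mk.inj h
      exact ⟨h2, h1, rfl⟩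
  rw [h, Finset.card_map, Finset.card_range]

theorem card_eq_sum_columns {n : ℕ} (lam : n.Partition) (s : Finset (Fin n)) :
    s.card = ∑ j ∈ Finset.univ.image fun i => (canonicalTableau lam i).2,
      (s.filter fun i => (canonicalTableau lam i).2 = j).card :=
  Finset.card_eq_sum_card_fiberwise fun i _ => by simp

/-- Think of `ρ` as assigning new rows, injectively on each column. Then a column has at most `r`
entries with `ρ < r`, and at most `colLen j` entries in all; the canonical rows attain the minimum
of these bounds. -/
theorem card_column_lt_le {n : ℕ} (lam : n.Partition) {ρ : Fin n → ℕ}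
    (h : ∀ x y, ρ x = ρ y → (canonicalTableau lam x).2 = (canonicalTableau lam y).2 → x = y)
    (j r : ℕ) :
    ((Finset.univ.filter fun i => ρ i < r).filter fun i => (canonicalTableau lam i).2 = j).card ≤
      ((Finset.univ.filter fun i => (canonicalTableau lam i).1 < r).filter
        fun i => (canonicalTableau lam i).2 = j).card := by
  rw [Finset.filter_filter, Finset.filter_filter, card_column_rowsBefore, ← card_column]
  refine le_min ?_ (Finset.card_le_card fun i hi => ?_)
  · rw [← Finset.card_range r]
    refine Finset.card_le_card_of_injOn ρ (fun i hi => ?_) fun x hx y hy hxy => ?_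
    · simp only [Finset.coe_filter, Finset.mem_univ, true_and, Set.mem_ofPred_eq] at hi
      simpa using hi.1
    · simp only [Finset.coe_filter, Finset.mem_univ, true_and, Set.mem_ofPred_eq] at hx hy
      exact h x y hxy (hx.2.trans hy.2.symm)
  · simp only [Finset.mem_filter, Finset.mem_univ, true_and] at hi ⊢
    exact hi.2

theorem card_lt_le_rowsBefore {n : ℕ} (lam : n.Partition) {ρ : Fin n → ℕ}
    (h : ∀ x y, ρ x = ρ y → (canonicalTableau lam x).2 = (canonicalTableau lam y).2 → x = y)
    (r : ℕ) : (Finset.univ.filter fun i => ρ i < r).card ≤ rowsBefore lam r := by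
  rw [rowsBefore, card_eq_sum_columns lam, card_eq_sum_columns lam (Finset.univ.filter fun i =>
    (canonicalTableau lam i).1 < r)]
  exact Finset.sum_le_sum fun j _ => card_column_lt_le lam h j r

/-- Equality of the totals forces equality in every column. Taking `r` to be the length of the
column of `x` shows that all its entries have `ρ < r`. -/
theorem mem_diagram_of_card_lt_eq {n : ℕ} (lam : n.Partition) {ρ : Fin n → ℕ}
    (h : ∀ x y, ρ x = ρ y → (canonicalTableau lam x).2 = (canonicalTableau lam y).2 → x = y)
    (hr : ∀ r, (Finset.univ.filter fun i => ρ i < r).card = rowsBefore lam r) (x : Fin n) :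
    (ρ x, (canonicalTableau lam x).2) ∈ partitionDiagram lam := by
  rw [YoungDiagram.mem_iff_lt_colLen]
  set j := (canonicalTableau lam x).2 with hj
  set r := (partitionDiagram lam).colLen j with hrj
  have h1 := hr r
  rw [rowsBefore, card_eq_sum_columns lam, card_eq_sum_columns lam (Finset.univ.filter fun i =>
    (canonicalTableau lam i).1 < r), Finset.sum_eq_sum_iff_of_le
    fun j _ => card_column_lt_le lam h j r] at h1
  have h2 := h1 j (Finset.mem_image_of_mem _ (Finset.mem_univ x))
  rw [Finset.filter_filter, Finset.filter_filter, card_column_rowsBefore, ← hrj, min_self,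
    hrj, ← card_column] at h2
  have h3 := Finset.eq_of_subset_of_card_le (fun i hi => by
    simp only [Finset.mem_filter, Finset.mem_univ, true_and] at hi ⊢
    exact hi.2) h2.ge
  have h4 : x ∈ Finset.univ.filter fun i => (canonicalTableau lam i).2 = j := by simp [hj]
  rw [← h3] at h4
  simp only [Finset.mem_filter, Finset.mem_univ, true_and] at h4
  rw [hrj, ← card_column]
  exact h4.1

theorem rowLen_add_rowsBefore {n : ℕ} (lam : n.Partition) (r : ℕ) :
    rowsBefore lam (r + 1) = rowsBefore lam r + (partitionDiagram lam).rowLen r := by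
  rw [rowsBefore, rowsBefore, card_filter_tableau lam fun c => c.1 < r + 1,
    card_filter_tableau lam fun c => c.1 < r, YoungDiagram.rowLen_eq_card, YoungDiagram.row,
    ← Finset.card_union_of_disjoint, ← Finset.filter_or]
  · congr 1
    ext c
    simp only [Finset.mem_filter, Nat.lt_succ_iff_lt_or_eq]
  · exact Finset.disjoint_filter.2 fun c _ h h' => by omega

theorem partition_eq_of_rowsBefore_eq {n : ℕ} {lam mu : n.Partition}
    (h : ∀ r, rowsBefore lam r = rowsBefore mu r) : lam = mu := by
  have hd : partitionDiagram lam = partitionDiagram mu := by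
    ext ⟨i, j⟩
    rw [YoungDiagram.mem_cells, YoungDiagram.mem_cells, YoungDiagram.mem_iff_lt_rowLen,
      YoungDiagram.mem_iff_lt_rowLen]
    have h1 := rowLen_add_rowsBefore lam i
    have h2 := rowLen_add_rowsBefore mu i
    rw [h, h] at h1
    omega
  have hpos : ∀ lam : n.Partition, ∀ x ∈ partitionRows lam, 0 < x := fun lam x hx =>
    lam.parts_pos ((Multiset.mem_sort _).1 hx)
  have hrow := congrArg YoungDiagram.rowLens hd
  rw [partitionDiagram, partitionDiagram, YoungDiagram.rowLens_ofRowLens_eq_self (hpos lam),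
    YoungDiagram.rowLens_ofRowLens_eq_self (hpos mu)] at hrow
  have := congrArg (fun l : List ℕ => (l : Multiset ℕ)) hrow
  simp only [partitionRows, Multiset.sort_eq] at this
  exact Nat.Partition.ext this

theorem card_filter_comp_perm {n : ℕ} (g : Equiv.Perm (Fin n)) (p : Fin n → Prop)
    [DecidablePred p] :
    (Finset.univ.filter fun i => p (g i)).card = (Finset.univ.filter p).card := by
  refine Finset.card_bij (fun i _ => g i) (by simp) (fun _ _ _ _ h => g.injective h) fun b hb =>
    ⟨g.symm b, by simpa using hb, by simp⟩

/-- Unless the shape `lam` dominates the shape `mu`, two entries share a row of a given tableau of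
shape `mu` and a column of the canonical tableau of shape `lam`. -/
theorem exists_ne_same_row_column {n : ℕ} {lam mu : n.Partition} {r : ℕ}
    (hr : rowsBefore lam r < rowsBefore mu r) (g : Equiv.Perm (Fin n)) :
    ∃ x y, x ≠ y ∧ (canonicalTableau mu (g x)).1 = (canonicalTableau mu (g y)).1 ∧
      (canonicalTableau lam x).2 = (canonicalTableau lam y).2 := by
  by_contra! hne
  have := card_lt_le_rowsBefore lam (ρ := fun x => (canonicalTableau mu (g x)).1)
    (fun x y h1 h2 => by_contra fun h => hne x y h h1 h2) r
  rw [card_filter_comp_perm g fun i => (canonicalTableau mu i).1 < r] at this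
  exact absurd this (not_le.2 hr)

/-- A permutation is either a product of a row and a column permutation, or it makes two entries
of one row share a column. -/
theorem exists_mul_or_exists_ne {n : ℕ} (lam : n.Partition) (g : Equiv.Perm (Fin n)) :
    (∃ p ∈ rowGroup lam, ∃ q ∈ columnGroup lam, g = p * q) ∨
      ∃ x y, x ≠ y ∧ (canonicalTableau lam (g x)).1 = (canonicalTableau lam (g y)).1 ∧
        (canonicalTableau lam x).2 = (canonicalTableau lam y).2 := by
  refine or_iff_not_imp_right.2 fun hne => ?_
  push Not at hne
  have hinj : ∀ x y, (canonicalTableau lam (g x)).1 = (canonicalTableau lam (g y)).1 →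
      (canonicalTableau lam x).2 = (canonicalTableau lam y).2 → x = y :=
    fun x y h1 h2 => by_contra fun h => hne x y h h1 h2
  have hmem := mem_diagram_of_card_lt_eq lam
    (ρ := fun x => (canonicalTableau lam (g x)).1) hinj fun r =>
      card_filter_comp_perm g fun i => (canonicalTableau lam i).1 < r
  -- `q x` is the entry of the canonical tableau in the row of `g x` and the column of `x`, so `q`
  -- preserves columns and `g * q⁻¹` preserves rows.
  choose q hq using fun x => exists_canonicalTableau_eq (hmem x)
  have hqinj : Function.Injective q := fun x y h => by
    have h' := hq y
    rw [← h, hq x, Prod.mk.injEq] at h'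
    exact hinj x y h'.1 h'.2
  let q' : Equiv.Perm (Fin n) := Equiv.ofBijective q (Finite.injective_iff_bijective.1 hqinj)
  refine ⟨g * q'⁻¹, fun i => ?_, q', fun i => ?_, by simp⟩
  · obtain ⟨x, rfl⟩ := q'.surjective i
    have : (canonicalTableau lam (q' x)).1 = _ := congrArg Prod.fst (hq x)
    simp [this]
  · have : (canonicalTableau lam (q i)).2 = _ := congrArg Prod.snd (hq i)
    exact this

theorem eq_one_of_mem_rowGroup_of_mem_columnGroup {n : ℕ} {lam : n.Partition}
    {g : Equiv.Perm (Fin n)} (hr : g ∈ rowGroup lam) (hc : g ∈ columnGroup lam) : g = 1 :=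
  Equiv.ext fun i => canonicalTableau_injective lam (Prod.ext (hr i) (hc i))

theorem swap_mem_rowGroup {n : ℕ} {lam : n.Partition} {x y : Fin n}
    (h : (canonicalTableau lam x).1 = (canonicalTableau lam y).1) :
    Equiv.swap x y ∈ rowGroup lam := fun i => by
  rw [Equiv.swap_apply_def]
  split_ifs with h1 h2 <;> simp_all

theorem swap_mem_columnGroup {n : ℕ} {lam : n.Partition} {x y : Fin n}
    (h : (canonicalTableau lam x).2 = (canonicalTableau lam y).2) :
    Equiv.swap x y ∈ columnGroup lam := fun i => by
  rw [Equiv.swap_apply_def]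
  split_ifs with h1 h2 <;> simp_all

/-! ### Traces and characters in a group algebra -/

section GroupAlgebra

variable {G : Type*} [Group G] [Fintype G]

theorem MonoidAlgebra.eq_sum_coeff_smul_of (x : MonoidAlgebra ℂ G) :
    x = ∑ g, x.coeff g • MonoidAlgebra.of ℂ G g := by
  classical
  ext h
  rw [MonoidAlgebra.coeff_sum, Finset.sum_apply']
  simp [Finsupp.single_apply]

theorem MonoidAlgebra.coeff_mul_eq_sum (x y : MonoidAlgebra ℂ G) (h : G) :
    (x * y).coeff h = ∑ g, x.coeff g * y.coeff (g⁻¹ * h) := by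
  conv_lhs => rw [x.eq_sum_coeff_smul_of, Finset.sum_mul]
  rw [MonoidAlgebra.coeff_sum, Finset.sum_apply']
  simp [MonoidAlgebra.coeff_single_mul_apply]

theorem MonoidAlgebra.trace_mulLeft_comp_mulRight (g : G) (y : MonoidAlgebra ℂ G) :
    LinearMap.trace ℂ (MonoidAlgebra ℂ G)
      (LinearMap.mulLeft ℂ (MonoidAlgebra.of ℂ G g) ∘ₗ LinearMap.mulRight ℂ y) =
      ∑ h, y.coeff (h⁻¹ * g⁻¹ * h) := by
  classical
  rw [LinearMap.trace_eq_matrix_trace ℂ (MonoidAlgebra.basis G ℂ), Matrix.trace]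
  refine Finset.sum_congr rfl fun h _ => ?_
  rw [Matrix.diag_apply, LinearMap.toMatrix_apply, MonoidAlgebra.basis_apply]
  change (MonoidAlgebra.of ℂ G g * (MonoidAlgebra.single h 1 * y)).coeff h = _
  simp [MonoidAlgebra.coeff_single_mul_apply, mul_assoc]

/-- If `k = 0`, right multiplication by `x` is nilpotent and has trace zero; but its trace is the
order of `G` times `x.coeff 1`. -/
theorem MonoidAlgebra.ne_zero_of_mul_self_eq_smul {x : MonoidAlgebra ℂ G} {k : ℂ}
    (hx : x.coeff 1 ≠ 0) (hk : x * x = k • x) : k ≠ 0 := by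
  rintro rfl
  have hn : IsNilpotent (LinearMap.mulRight ℂ x) := ⟨2, by
    rw [LinearMap.pow_mulRight, pow_two, hk, zero_smul, LinearMap.mulRight_zero_eq_zero]⟩
  have h0 := (LinearMap.isNilpotent_trace_of_isNilpotent hn).eq_zero
  have h1 := MonoidAlgebra.trace_mulLeft_comp_mulRight (1 : G) x
  rw [map_one, LinearMap.mulLeft_one, LinearMap.id_comp, h0] at h1
  simp [hx] at h1

/-- The trace of left multiplication by `g` on the left ideal generated by an idempotent `e`. -/
def idempotentCharacter (e : MonoidAlgebra ℂ G) (g : G) : ℂ :=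
  ∑ h, e.coeff (h⁻¹ * g⁻¹ * h)

/-- Expanding both characters gives sums over conjugators `h` and `k`. After summing over `g` only
`m = h⁻¹ * k` matters, so the sum over `h` contributes the factor `Fintype.card G`. Vanishing of all
`e * m * f` then gives orthogonality. -/
theorem sum_idempotentCharacter_mul (e f : MonoidAlgebra ℂ G) :
    ∑ g, idempotentCharacter e g * idempotentCharacter f g⁻¹ =
      Fintype.card G * ∑ m, (e * MonoidAlgebra.of ℂ G m * f).coeff m := by
  have key : ∀ h : G, ∑ g, ∑ k, e.coeff (h⁻¹ * g⁻¹ * h) * f.coeff (k⁻¹ * g⁻¹⁻¹ * k) =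
      ∑ m, (e * MonoidAlgebra.of ℂ G m * f).coeff m := fun h => by
    rw [Finset.sum_comm]
    refine Fintype.sum_equiv (Equiv.mulLeft h⁻¹) _ _ fun k => ?_
    rw [mul_assoc, MonoidAlgebra.coeff_mul_eq_sum]
    refine Fintype.sum_equiv ((Equiv.inv G).trans (MulAut.conj h⁻¹).toEquiv) _ _ fun g => ?_
    simp [MonoidAlgebra.coeff_single_mul_apply, mul_assoc]
  simp only [idempotentCharacter, Finset.sum_mul_sum]
  rw [Finset.sum_comm, Finset.sum_congr rfl fun h _ => key h, Finset.sum_const, nsmul_eq_mul,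
    Finset.card_univ]

end GroupAlgebra

/-! ### Young symmetrizers and their idempotents -/

section YoungSymmetrizer

variable {n : ℕ}

open Classical in
/-- The sum of the row group in the group algebra. -/
def rowSum (lam : n.Partition) : SymGroupAlgebra n :=
  ∑ p : rowGroup lam, MonoidAlgebra.of ℂ _ (p : Equiv.Perm (Fin n))

open Classical in
/-- The signed sum of the column group in the group algebra. -/
def columnSum (lam : n.Partition) : SymGroupAlgebra n :=
  ∑ q : columnGroup lam, ((Equiv.Perm.sign (q : Equiv.Perm (Fin n)) : ℤ) : ℂ) •
    MonoidAlgebra.of ℂ _ (q : Equiv.Perm (Fin n))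

theorem youngSymmetrizer_eq (lam : n.Partition) :
    youngSymmetrizer lam = rowSum lam * columnSum lam := rfl

theorem rowSum_mul_of (lam : n.Partition) {p : Equiv.Perm (Fin n)} (hp : p ∈ rowGroup lam) :
    rowSum lam * MonoidAlgebra.of ℂ _ p = rowSum lam := by
  classical
  rw [rowSum, Finset.sum_mul]
  refine Fintype.sum_equiv (Equiv.mulRight (⟨p, hp⟩ : rowGroup lam)) _ _ fun q => ?_
  rw [← map_mul]
  rfl

theorem of_mul_columnSum (lam : n.Partition) {q : Equiv.Perm (Fin n)}
    (hq : q ∈ columnGroup lam) :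
    MonoidAlgebra.of ℂ _ q * columnSum lam =
      ((Equiv.Perm.sign q : ℤ) : ℂ) • columnSum lam := by
  classical
  rw [columnSum, Finset.mul_sum, Finset.smul_sum]
  refine Fintype.sum_equiv (Equiv.mulLeft (⟨q, hq⟩ : columnGroup lam)) _ _ fun p => ?_
  rw [mul_smul_comm, ← map_mul, smul_smul]
  have h : ((Equiv.Perm.sign q : ℤ) : ℂ) * ((Equiv.Perm.sign q : ℤ) : ℂ) = 1 := by
    rw [← Int.cast_mul, ← Units.val_mul, Int.units_mul_self]
    simp
  have h' : ((Equiv.Perm.sign (q * (p : Equiv.Perm (Fin n))) : ℤ) : ℂ) =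
      ((Equiv.Perm.sign q : ℤ) : ℂ) * ((Equiv.Perm.sign (p : Equiv.Perm (Fin n)) : ℤ) : ℂ) := by
    rw [Equiv.Perm.sign_mul, Units.val_mul, Int.cast_mul]
  change _ = (_ * ((Equiv.Perm.sign (q * (p : Equiv.Perm (Fin n))) : ℤ) : ℂ)) •
    MonoidAlgebra.of ℂ _ (q * (p : Equiv.Perm (Fin n)))
  rw [h', ← mul_assoc, h, one_mul]

/-- The transposition of `g x` and `g y` is absorbed by the row sum. Moved past `g` it becomes the
transposition of `x` and `y`, which the column sum absorbs with sign `-1`; the product is thus its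
own negative. -/
theorem rowSum_mul_of_mul_columnSum_eq_zero {lam mu : n.Partition} {g : Equiv.Perm (Fin n)}
    {x y : Fin n} (hxy : x ≠ y)
    (hr : (canonicalTableau mu (g x)).1 = (canonicalTableau mu (g y)).1)
    (hc : (canonicalTableau lam x).2 = (canonicalTableau lam y).2) :
    rowSum mu * MonoidAlgebra.of ℂ _ g * columnSum lam = 0 := by
  have h : rowSum mu * MonoidAlgebra.of ℂ _ g * columnSum lam =
      -(rowSum mu * MonoidAlgebra.of ℂ _ g * columnSum lam) := by
    conv_lhs => rw [← rowSum_mul_of mu (swap_mem_rowGroup hr), mul_assoc (rowSum mu), ← map_mul,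
      ← Equiv.mul_swap_eq_swap_mul, map_mul, ← mul_assoc, mul_assoc _ _ (columnSum lam),
      of_mul_columnSum lam (swap_mem_columnGroup hc), Equiv.Perm.sign_swap hxy]
    simp
  have h2 : (2 : ℂ) • (rowSum mu * MonoidAlgebra.of ℂ _ g * columnSum lam) = 0 := by
    rw [two_smul]
    exact eq_neg_iff_add_eq_zero.1 h
  exact (smul_eq_zero.1 h2).resolve_left two_ne_zero

theorem rowSum_mul_of_mul_columnSum_mem (lam : n.Partition) (g : Equiv.Perm (Fin n)) :
    rowSum lam * MonoidAlgebra.of ℂ _ g * columnSum lam ∈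
      Submodule.span ℂ {youngSymmetrizer lam} := by
  obtain ⟨p, hp, q, hq, rfl⟩ | ⟨x, y, hxy, hr, hc⟩ := exists_mul_or_exists_ne lam g
  · rw [map_mul, ← mul_assoc, rowSum_mul_of lam hp, mul_assoc, of_mul_columnSum lam hq,
      mul_smul_comm]
    exact Submodule.smul_mem _ _ (Submodule.mem_span_singleton_self _)
  · rw [rowSum_mul_of_mul_columnSum_eq_zero hxy hr hc]
    exact Submodule.zero_mem _

theorem rowSum_mul_mul_columnSum_mem (lam : n.Partition) (z : SymGroupAlgebra n) :
    rowSum lam * z * columnSum lam ∈ Submodule.span ℂ {youngSymmetrizer lam} := by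
  rw [z.eq_sum_coeff_smul_of, Finset.mul_sum, Finset.sum_mul]
  refine Submodule.sum_mem _ fun g _ => ?_
  rw [mul_smul_comm, smul_mul_assoc]
  exact Submodule.smul_mem _ _ (rowSum_mul_of_mul_columnSum_mem lam g)

/-- The inner factors `columnSum lam * z * rowSum lam` are an arbitrary element between a row sum
and a column sum, which always gives a multiple of the symmetrizer. -/
theorem exists_youngSymmetrizer_mul_mul_eq_smul (lam : n.Partition) (z : SymGroupAlgebra n) :
    ∃ t : ℂ, youngSymmetrizer lam * z * youngSymmetrizer lam = t • youngSymmetrizer lam := by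
  have h := rowSum_mul_mul_columnSum_mem lam (columnSum lam * z * rowSum lam)
  obtain ⟨t, ht⟩ := Submodule.mem_span_singleton.1 h
  refine ⟨t, ?_⟩
  rw [ht, youngSymmetrizer_eq]
  noncomm_ring

theorem youngSymmetrizer_mul_mul_eq_zero {lam mu : n.Partition} {r : ℕ}
    (hr : rowsBefore lam r < rowsBefore mu r) (z : SymGroupAlgebra n) :
    youngSymmetrizer mu * z * youngSymmetrizer lam = 0 := by
  have h : ∀ z : SymGroupAlgebra n, rowSum mu * z * columnSum lam = 0 := fun z => by
    rw [z.eq_sum_coeff_smul_of, Finset.mul_sum, Finset.sum_mul]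
    refine Finset.sum_eq_zero fun g _ => ?_
    obtain ⟨x, y, hxy, h1, h2⟩ := exists_ne_same_row_column hr g
    rw [mul_smul_comm, smul_mul_assoc, rowSum_mul_of_mul_columnSum_eq_zero hxy h1 h2, smul_zero]
  have h' := h (columnSum mu * z * rowSum lam)
  rw [← h', youngSymmetrizer_eq, youngSymmetrizer_eq]
  noncomm_ring

/-- The row and column groups meet trivially, so `p * q = 1` only for `p = q = 1`. -/
theorem youngSymmetrizer_coeff_one (lam : n.Partition) : (youngSymmetrizer lam).coeff 1 = 1 := by
  classical
  rw [youngSymmetrizer_eq, rowSum, columnSum, Finset.sum_mul_sum]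
  simp only [MonoidAlgebra.coeff_sum, Finset.sum_apply', mul_smul_comm,
    MonoidAlgebra.coeff_smul_apply, MonoidAlgebra.of_apply, MonoidAlgebra.single_mul_single,
    one_mul, MonoidAlgebra.coeff_single, Finsupp.single_apply]
  have key : ∀ (p : rowGroup lam) (q : columnGroup lam),
      (p : Equiv.Perm (Fin n)) * (q : Equiv.Perm (Fin n)) = 1 → p = 1 ∧ q = 1 := fun p q h => by
    have hp : (p : Equiv.Perm (Fin n)) = 1 := by
      refine eq_one_of_mem_rowGroup_of_mem_columnGroup p.2 ?_
      rw [eq_inv_of_mul_eq_one_left h]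
      exact inv_mem q.2
    refine ⟨Subtype.ext hp, Subtype.ext ?_⟩
    rwa [hp, one_mul] at h
  rw [Finset.sum_eq_single 1, Finset.sum_eq_single 1]
  · simp
  · intro q _ hq
    rw [if_neg fun h => hq (key 1 q h).2, smul_zero]
  · simp
  · intro p _ hp
    refine Finset.sum_eq_zero fun q _ => ?_
    rw [if_neg fun h => hp (key p q h).1, smul_zero]
  · simp

theorem exists_youngSymmetrizer_mul_self (lam : n.Partition) :
    ∃ k : ℂ, k ≠ 0 ∧ youngSymmetrizer lam * youngSymmetrizer lam = k • youngSymmetrizer lam := by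
  obtain ⟨k, hk⟩ := exists_youngSymmetrizer_mul_mul_eq_smul lam 1
  rw [mul_one] at hk
  exact ⟨k, MonoidAlgebra.ne_zero_of_mul_self_eq_smul
    (by simp [youngSymmetrizer_coeff_one]) hk, hk⟩

/-- The scalar `k` with `c * c = k • c` for the Young symmetrizer `c`. -/
def youngScalar (lam : n.Partition) : ℂ := (exists_youngSymmetrizer_mul_self lam).choose

theorem youngScalar_ne_zero (lam : n.Partition) : youngScalar lam ≠ 0 :=
  (exists_youngSymmetrizer_mul_self lam).choose_spec.1

theorem youngSymmetrizer_mul_self (lam : n.Partition) :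
    youngSymmetrizer lam * youngSymmetrizer lam = youngScalar lam • youngSymmetrizer lam :=
  (exists_youngSymmetrizer_mul_self lam).choose_spec.2

/-- The idempotent proportional to the Young symmetrizer. -/
def youngIdempotent (lam : n.Partition) : SymGroupAlgebra n :=
  (youngScalar lam)⁻¹ • youngSymmetrizer lam

theorem youngSymmetrizer_mul_youngIdempotent (lam : n.Partition) :
    youngSymmetrizer lam * youngIdempotent lam = youngSymmetrizer lam := by
  rw [youngIdempotent, mul_smul_comm, youngSymmetrizer_mul_self, smul_smul,
    inv_mul_cancel₀ (youngScalar_ne_zero lam), one_smul]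

theorem youngIdempotent_mul_self (lam : n.Partition) :
    youngIdempotent lam * youngIdempotent lam = youngIdempotent lam := by
  conv_lhs => enter [1]; rw [youngIdempotent]
  rw [smul_mul_assoc, youngSymmetrizer_mul_youngIdempotent, youngIdempotent]

theorem youngIdempotent_ne_zero (lam : n.Partition) : youngIdempotent lam ≠ 0 := fun h => by
  have h1 := youngSymmetrizer_mul_youngIdempotent lam
  have h2 := youngSymmetrizer_coeff_one lam
  rw [← h1, h, mul_zero] at h2
  simp at h2

theorem youngIdempotent_mem (lam : n.Partition) : youngIdempotent lam ∈ spechtModule lam := by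
  rw [youngIdempotent, ← smul_one_mul]
  exact Ideal.mul_mem_left _ _ (Ideal.mem_span_singleton_self _)

theorem mul_youngIdempotent_of_mem {lam : n.Partition} {z : SymGroupAlgebra n}
    (hz : z ∈ spechtModule lam) : z * youngIdempotent lam = z := by
  obtain ⟨a, rfl⟩ := Ideal.mem_span_singleton'.1 hz
  rw [mul_assoc, youngSymmetrizer_mul_youngIdempotent]

/-- The Specht module is the image of right multiplication by the idempotent. Factoring this
projection as `i ∘ₗ p` and using the cyclicity of the trace moves the computation to the whole group
algebra. -/
theorem spechtCharacter_eq (lam : n.Partition) (σ : Equiv.Perm (Fin n)) :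
    spechtCharacter lam σ = idempotentCharacter (youngIdempotent lam) σ := by
  let i : spechtModule lam →ₗ[ℂ] SymGroupAlgebra n := (spechtModule lam).subtype.restrictScalars ℂ
  let p : SymGroupAlgebra n →ₗ[ℂ] spechtModule lam :=
    (LinearMap.toSpanSingleton (SymGroupAlgebra n) (spechtModule lam)
      ⟨youngIdempotent lam, youngIdempotent_mem lam⟩).restrictScalars ℂ
  have : Module.Finite ℂ (spechtModule lam) :=
    Module.Finite.of_injective i (Submodule.injective_subtype _)
  have h1 : spechtRepresentation lam σ =
      p ∘ₗ (LinearMap.mulLeft ℂ (MonoidAlgebra.of ℂ _ σ) ∘ₗ i) := by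
    refine LinearMap.ext fun z => Subtype.ext ?_
    change MonoidAlgebra.of ℂ _ σ * (z : SymGroupAlgebra n) =
      MonoidAlgebra.of ℂ _ σ * (z : SymGroupAlgebra n) * youngIdempotent lam
    rw [mul_assoc, mul_youngIdempotent_of_mem z.2]
  have h2 : (LinearMap.mulLeft ℂ (MonoidAlgebra.of ℂ _ σ) ∘ₗ i) ∘ₗ p =
      LinearMap.mulLeft ℂ (MonoidAlgebra.of ℂ _ σ) ∘ₗ
        LinearMap.mulRight ℂ (youngIdempotent lam) := rfl
  rw [spechtCharacter, Representation.character, h1, LinearMap.trace_comp_comm', h2,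
    MonoidAlgebra.trace_mulLeft_comp_mulRight, idempotentCharacter]

theorem youngIdempotent_mul_mul_eq_zero {lam mu : n.Partition} {r : ℕ}
    (hr : rowsBefore lam r < rowsBefore mu r) (z : SymGroupAlgebra n) :
    youngIdempotent mu * z * youngIdempotent lam = 0 := by
  rw [youngIdempotent, youngIdempotent, smul_mul_assoc, smul_mul_assoc, mul_smul_comm,
    youngSymmetrizer_mul_mul_eq_zero hr, smul_zero, smul_zero]

theorem exists_youngIdempotent_mul_mul_eq_smul (lam : n.Partition) (z : SymGroupAlgebra n) :
    ∃ t : ℂ, youngIdempotent lam * z * youngIdempotent lam = t • youngIdempotent lam := by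
  obtain ⟨t, ht⟩ := exists_youngSymmetrizer_mul_mul_eq_smul lam z
  refine ⟨(youngScalar lam)⁻¹ * t, ?_⟩
  simp only [youngIdempotent, smul_mul_assoc, mul_smul_comm, ht, smul_smul]
  congr 1
  ring

end YoungSymmetrizer

/-! ### Orthogonality and completeness of the Specht characters -/

theorem sum_spechtCharacter_mul_inv_eq_zero {n : ℕ} {lam mu : n.Partition} {r : ℕ}
    (hr : rowsBefore lam r < rowsBefore mu r) :
    ∑ σ, spechtCharacter mu σ * spechtCharacter lam σ⁻¹ = 0 := by
  simp only [spechtCharacter_eq]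
  rw [sum_idempotentCharacter_mul]
  simp [youngIdempotent_mul_mul_eq_zero hr]

/-- With `e` the idempotent and `e * m * e = t m • e`, the sum needed is that of `t m * e.coeff m`.
Expanding the middle factor of `e * e * e = e` shows that it equals `1`. -/
theorem sum_spechtCharacter_mul_inv_self {n : ℕ} (lam : n.Partition) :
    ∑ σ, spechtCharacter lam σ * spechtCharacter lam σ⁻¹ = n.factorial := by
  simp only [spechtCharacter_eq]
  rw [sum_idempotentCharacter_mul, Fintype.card_perm, Fintype.card_fin]
  choose t ht using fun m : Equiv.Perm (Fin n) =>
    exists_youngIdempotent_mul_mul_eq_smul lam (MonoidAlgebra.of ℂ _ m)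
  have h1 : (∑ m, (youngIdempotent lam).coeff m * t m) • youngIdempotent lam =
      (1 : ℂ) • youngIdempotent lam := by
    have h2 : youngIdempotent lam * youngIdempotent lam * youngIdempotent lam =
        youngIdempotent lam := by rw [youngIdempotent_mul_self, youngIdempotent_mul_self]
    conv_rhs => rw [one_smul, ← h2]
    conv_rhs => enter [1, 2]; rw [(youngIdempotent lam).eq_sum_coeff_smul_of]
    rw [Finset.mul_sum, Finset.sum_mul, Finset.sum_smul]
    refine Finset.sum_congr rfl fun m _ => ?_
    rw [mul_smul_comm, smul_mul_assoc, ht, smul_smul]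
  have h3 := smul_left_injective ℂ (youngIdempotent_ne_zero lam) h1
  simp only [ht, MonoidAlgebra.coeff_smul_apply, smul_eq_mul]
  rw [Finset.sum_congr rfl fun m _ => mul_comm (t m) _, h3, mul_one]

/-- The cycle type of a permutation of `[n]`, as a partition of `n`. -/
def cyclePartition {n : ℕ} (σ : Equiv.Perm (Fin n)) : n.Partition where
  parts := σ.partition.parts
  parts_pos := σ.partition.parts_pos
  parts_sum := σ.partition.parts_sum.trans (Fintype.card_fin n)

theorem isConj_of_cyclePartition_eq {n : ℕ} {σ τ : Equiv.Perm (Fin n)}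
    (h : cyclePartition σ = cyclePartition τ) : IsConj σ τ :=
  Equiv.Perm.partition_eq_of_isConj.2 (Nat.Partition.ext (congrArg Nat.Partition.parts h :))

theorem spechtCharacter_eq_of_isConj {n : ℕ} (lam : n.Partition) {σ τ : Equiv.Perm (Fin n)}
    (h : IsConj σ τ) : spechtCharacter lam σ = spechtCharacter lam τ := by
  obtain ⟨g, rfl⟩ := isConj_iff.1 h
  exact ((spechtRepresentation lam).char_conj σ g).symm

theorem spechtCharacter_inv {n : ℕ} (lam : n.Partition) (σ : Equiv.Perm (Fin n)) :
    spechtCharacter lam σ⁻¹ = spechtCharacter lam σ :=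
  spechtCharacter_eq_of_isConj lam (Equiv.Perm.isConj_of_cycleType_eq σ.cycleType_inv)

theorem sum_spechtCharacter_mul {n : ℕ} (lam mu : n.Partition) :
    ∑ σ, spechtCharacter lam σ * spechtCharacter mu σ =
      if lam = mu then (n.factorial : ℂ) else 0 := by
  split_ifs with h
  · subst h
    conv_lhs => enter [2, σ, 2]; rw [← spechtCharacter_inv]
    exact sum_spechtCharacter_mul_inv_self lam
  · obtain ⟨r, hr⟩ : ∃ r, rowsBefore lam r ≠ rowsBefore mu r := by
      by_contra! h'
      exact h (partition_eq_of_rowsBefore_eq h')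
    -- One differing row count suffices, so partitions incomparable in dominance order need no
    -- separate case; the two signs exchange the roles of `lam` and `mu`.
    rcases lt_or_gt_of_ne hr with hr | hr
    · rw [← sum_spechtCharacter_mul_inv_eq_zero hr]
      exact Finset.sum_congr rfl fun σ _ => by rw [spechtCharacter_inv, mul_comm]
    · rw [← sum_spechtCharacter_mul_inv_eq_zero hr]
      exact Finset.sum_congr rfl fun σ _ => by rw [spechtCharacter_inv]

theorem sum_linearCombination_spechtCharacter_mul {n : ℕ} (a : n.Partition → ℂ)
    (mu : n.Partition) :
    ∑ σ, (∑ lam, a lam * spechtCharacter lam σ) * spechtCharacter mu σ =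
      a mu * n.factorial := by
  simp only [Finset.sum_mul, mul_assoc]
  rw [Finset.sum_comm]
  simp [← Finset.mul_sum, sum_spechtCharacter_mul]

/-- A class function on the symmetric group is a linear combination of the characters of the
Specht modules. -/
theorem exists_eq_sum_spechtCharacter {n : ℕ} {F : Equiv.Perm (Fin n) → ℂ}
    (hF : ∀ σ τ, IsConj σ τ → F σ = F τ) :
    ∃ a : n.Partition → ℂ, ∀ σ, F σ = ∑ lam, a lam * spechtCharacter lam σ := by
  have hext : ∀ F : Equiv.Perm (Fin n) → ℂ, (∀ σ τ, IsConj σ τ → F σ = F τ) →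
      ∃ X : n.Partition → ℂ, ∀ σ, X (cyclePartition σ) = F σ := fun F hF =>
    -- The value `0` off the range of `cyclePartition` is immaterial, since the functions are only
    -- evaluated at cycle types of permutations.
    ⟨Function.extend cyclePartition F 0, fun σ => Function.FactorsThrough.extend_apply
      (fun σ τ h => hF σ τ (isConj_of_cyclePartition_eq h)) 0 σ⟩
  obtain ⟨f, hf⟩ := hext F hF
  choose X hX using fun lam : n.Partition => hext (spechtCharacter lam)
    fun σ τ h => spechtCharacter_eq_of_isConj lam h
  have hli : LinearIndependent ℂ X := by
    refine Fintype.linearIndependent_iff.2 fun a ha mu => ?_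
    have h := sum_linearCombination_spechtCharacter_mul a mu
    have h0 : ∀ σ, ∑ lam, a lam * spechtCharacter lam σ = 0 := fun σ => by
      have := congrFun ha (cyclePartition σ)
      simpa [Finset.sum_apply, hX] using this
    simp only [h0, zero_mul, Finset.sum_const_zero] at h
    exact (mul_eq_zero.1 h.symm).resolve_right (Nat.cast_ne_zero.2 n.factorial_ne_zero)
  -- The independent family `X` is indexed by the partitions of `n`, and their number is the
  -- dimension of the space of functions on them.
  have hspan := hli.span_eq_top_of_card_eq_finrank' (Module.finrank_fintype_fun_eq_card ℂ).symm
  have hmem : f ∈ Submodule.span ℂ (Set.range X) := hspan ▸ Submodule.mem_top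
  obtain ⟨a, ha⟩ := (Submodule.mem_span_range_iff_exists_fun ℂ).1 hmem
  refine ⟨a, fun σ => ?_⟩
  rw [← hf, ← ha]
  simp [Finset.sum_apply, hX]

/-! ### From class functions to immanants -/

theorem numCycles_eq_of_isConj {n : ℕ} {σ τ : Equiv.Perm (Fin n)} (h : IsConj σ τ) :
    numCycles σ = numCycles τ := by
  obtain ⟨g, rfl⟩ := isConj_iff.1 h
  refine Nat.card_congr (Quotient.congr g fun x y => ?_)
  change σ.SameCycle x y ↔ (g * σ * g⁻¹).SameCycle (g x) (g y)
  rw [Equiv.Perm.sameCycle_conj]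
  simp

theorem pow_numCycles_eq_sum {n : ℕ} (x : ℂ) (σ : Equiv.Perm (Fin n)) :
    x ^ numCycles σ = ∑ lam : n.Partition, immanantCoeff lam x * spechtCharacter lam σ := by
  obtain ⟨a, ha⟩ := exists_eq_sum_spechtCharacter (F := fun σ => x ^ numCycles σ)
    fun σ τ h => congrArg _ (numCycles_eq_of_isConj h)
  have key : ∀ mu, immanantCoeff mu x = a mu := fun mu => by
    have hn : (n.factorial : ℂ) ≠ 0 := Nat.cast_ne_zero.2 n.factorial_ne_zero
    simp only [immanantCoeff, ha]
    rw [sum_linearCombination_spechtCharacter_mul]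
    field_simp
  simp only [key]
  exact ha σ

theorem alphaPermanent_eq_sum_immanant {n : ℕ} (x : ℂ) (M : Matrix (Fin n) (Fin n) ℂ) :
    alphaPermanent x M = ∑ lam : n.Partition, immanantCoeff lam x * immanant lam M := by
  simp only [alphaPermanent, immanant, pow_numCycles_eq_sum, Finset.sum_mul, Finset.mul_sum,
    mul_assoc]
  exact Finset.sum_comm

end

theorem mainTheorem6 (n : ℕ) (α β : ℂ) (hβ : β ≠ 0) (M : Matrix (Fin n) (Fin n) ℂ) :
    alphaPermanent α M =
      ∑ lam : n.Partition, immanantCoeff lam (-β) *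
        ∑ π : SetPartition n,
          fallingFactorial (-α / β) π.parts.card * immanant lam (blockProjection M π) := by
  -- The only use of `β ≠ 0`. The factor `-α / β` goes to the set partitions and `-β` to the
  -- immanant coefficients.
  have h : α = -α / β * -β := by field_simp
  conv_lhs => rw [h, alphaPermanent_mul]
  simp only [alphaPermanent_eq_sum_immanant, Finset.mul_sum]
  rw [Finset.sum_comm]
  exact Finset.sum_congr rfl fun _ _ => Finset.sum_congr rfl fun _ _ => mul_left_comm _ _ _
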